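/- Let $\mathcal N$ be a network: a finite directed acyclic multigraph $(\mathcal V,\mathcal E)$ with $s$ distinct source nodes $\sigma_1,\dots,\sigma_s$, none of which has an incoming edge, and a sink node $\gamma\notin\{\sigma_1,\dots,\sigma_s\}$ that is reachable by a directed path from every other node. A cut of $\mathcal N$ is a set $C\subseteq\mathcal E$ which, for some $i$, meets every path from $\sigma_i$ to $\gamma$; let $\Lambda(\mathcal N)$ be the set of all cuts. For a finite field $\mathbb F_q$ and a matrix $T\in\mathbb F_q^{s\times l}$, a $(k,n)$ network code for $T$ over $\mathbb F_q$ (with $k,n\ge 1$) works as follows. Each source $\sigma_i$ holds $k$ symbols $x_{i1},\dots,x_{ik}\in\mathbb F_q$. Each edge $e$ carries a word $u_e\in\mathbb F_q^n$: for an edge leaving $\sigma_i$, $u_e$ is an arbitrary (not necessarily linear) function of $(x_{i1},\dots,x_{ik})$ plus an error $z_e\in\mathbb F_q^n$; for any other edge, $u_e$ is an arbitrary function of the words on the edges entering the tail of $e$, plus an error $z_e\in\mathbb F_q^n$. From the words on the edges entering $\gamma$, a decoding function outputs $k$ vectors in $\mathbb F_q^l$. The code computes $\mathbf x\mapsto \mathbf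 x\cdot T$ against $\tau$ errors if these vectors are $(x_{1j},\dots,x_{sj})\cdot T$, $1\le j\le k$, for all source messages and all errors with $z_e\neq 0$ for at most $\tau$ edges $e$. The robust computing capacity $C(\mathcal N,T,\tau)$ is the supremum of $k/n$ over all $(k,n)$ network codes over $\mathbb F_q$ that compute $\mathbf x\mapsto\mathbf x\cdot T$ against $\tau$ errors. **Theorem.** Let $\mathcal N$ be such a network and let $\tau\ge 0$ be an integer with $2\tau<\min_{C\in\Lambda(\mathcal N)}|C|$. Then there is a number $q_0$, depending only on $\mathcal N$ and $\tau$, such that for every finite field $\mathbb F_q$ with $q\ge q_0$, every $l\ge 1$ and every $T\in\mathbb F_q^{s\times l}$ of full column rank, $$C(\mathcal N,T,\tau)\;\ge\;\min_{C\in\Lambda(\mathcal N)}\frac{|C|-2\tau}{l}.$$ -/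

import Mathlib

/-- A directed multigraph with vertex set `V` and edge set `E`. -/
structure DirMultigraph (V E : Type*) where
  tail : E → V
  head : E → V

/-- `G.IsPath u v p`: the nonempty edge sequence `p` is a (directed) path from `u` to `v`. -/
inductive DirMultigraph.IsPath {V E : Type*} (G : DirMultigraph V E) : V → V → List E → Prop
  | single (e : E) : G.IsPath (G.tail e) (G.head e) [e]
  | cons (e : E) {v : V} {p : List E} (hp : G.IsPath (G.head e) v p) :
      G.IsPath (G.tail e) v (e :: p)

/-- A network on an acyclic directed multigraph, with `s` distinct source nodes and one sink.
Sources have no incoming edges, and the sink can be reached from every other node. -/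
structure Network (V E : Type*) (s : ℕ) extends DirMultigraph V E where
  source : Fin s → V
  sink : V
  acyclic : ∀ v p, ¬ toDirMultigraph.IsPath v v p
  source_injective : Function.Injective source
  sink_ne_source : ∀ i, sink ≠ source i
  no_edge_into_source : ∀ e i, head e ≠ source i
  path_to_sink : ∀ v, v ≠ sink → ∃ p, toDirMultigraph.IsPath v sink p

namespace Network

variable {V E : Type*} {s : ℕ}

/-- The cuts of the network: the sets of edges that, for some source node, meet every path from
that source node to the sink. -/
def cuts (N : Network V E s) : Set (Finset E) :=
  {C | ∃ i, ∀ p, N.IsPath (N.source i) N.sink p → ∃ e ∈ p, e ∈ C}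

/-- The edges entering the node `v`. -/
abbrev In (N : Network V E s) (v : V) : Type _ := {d : E // N.head d = v}

/-- A (not necessarily linear) `(k, n)` network code over the alphabet `B`, for source messages in
`A ^ k` and results in `O ^ k`. Every edge carries a word in `B ^ n`. An edge `e` leaving the
`i`-th source node uses the encoder `srcEnc i e`, any other edge `e` uses `relayEnc e`
(the values of `srcEnc i e` for edges `e` that do not leave the `i`-th source node, and those of
`relayEnc e` for edges `e` that leave a source node, play no role). -/
structure Code (N : Network V E s) (A B O : Type*) (k n : ℕ) where
  srcEnc : Fin s → E → (Fin k → A) → (Fin n → B)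
  relayEnc : (e : E) → (N.In (N.tail e) → Fin n → B) → (Fin n → B)
  decode : (N.In N.sink → Fin n → B) → (Fin k → O)

namespace Code

variable {N : Network V E s} {A B O : Type*} [AddCommGroup B] {k n : ℕ}

/-- `c.IsTransmission x z u`: when the source messages are `x` and the error vector is `z`
(with the word `z e` added on the edge `e`), the word carried by each edge `e` is `u e`. -/
structure IsTransmission (c : N.Code A B O k n) (x : Fin s → Fin k → A)
    (z u : E → Fin n → B) : Prop where
  of_source : ∀ e i, N.tail e = N.source i → u e = c.srcEnc i e (x i) + z e
  of_relay : ∀ e, (∀ i, N.tail e ≠ N.source i) →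
    u e = c.relayEnc e (fun d => u d.1) + z e

/-- The code computes `f` (`k` times) against `τ` errors: whatever the source messages are, and
whatever errors occur on at most `τ` edges, the sink decodes the `k` values of `f` correctly. -/
def ComputesAgainst (c : N.Code A B O k n) (f : (Fin s → A) → O) (τ : ℕ) : Prop :=
  ∀ (x : Fin s → Fin k → A) (z u : E → Fin n → B),
    {e | z e ≠ 0}.ncard ≤ τ → c.IsTransmission x z u →
      ∀ j, c.decode (fun d => u d.1) j = f (fun i => x i j)

end Code

/-- The robust computing capacity: the supremum of the rates `k / n` of the `(k, n)` network
codes over `B` that compute `f` against `τ` errors. -/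
noncomputable def robustCapacity (N : Network V E s) {A O : Type*} (B : Type*) [AddCommGroup B]
    (f : (Fin s → A) → O) (τ : ℕ) : EReal :=
  sSup {r : EReal | ∃ k n : ℕ, 0 < k ∧ 0 < n ∧
    (∃ c : N.Code A B O k n, c.ComputesAgainst f τ) ∧ r = (((k : ℝ) / (n : ℝ) : ℝ) : EReal)}

theorem wellFounded_edges [Finite E] (N : Network V E s) :
    WellFounded (fun d e : E => N.head d = N.tail e) := by
  have key : ∀ d e : E, Relation.TransGen (fun d e : E => N.head d = N.tail e) d e →
      ∃ p, N.IsPath (N.tail d) (N.tail e) p := by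
    intro d e h
    induction h using Relation.TransGen.head_induction_on with
    | @single a h => exact ⟨[a], h ▸ DirMultigraph.IsPath.single a⟩
    | @head a b h _ ih =>
      obtain ⟨p, hp⟩ := ih
      exact ⟨a :: p, DirMultigraph.IsPath.cons a (h ▸ hp)⟩
  have : IsTrans E (Relation.TransGen (fun d e : E => N.head d = N.tail e)) :=
    ⟨fun _ _ _ => Relation.TransGen.trans⟩
  have : Std.Irrefl (Relation.TransGen (fun d e : E => N.head d = N.tail e)) :=
    ⟨fun e h => (key e e h).elim fun p hp => N.acyclic _ p hp⟩
  have wf := Finite.wellFounded_of_trans_of_irrefl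
    (Relation.TransGen (fun d e : E => N.head d = N.tail e))
  exact ⟨fun e => (Subrelation.accessible (q := fun d e : E => N.head d = N.tail e)
    (fun h => Relation.TransGen.single (r := fun d e : E => N.head d = N.tail e) h)
    (wf.apply e))⟩

/-- Source messages and errors determine the words carried by the edges. -/
theorem Code.existsUnique_isTransmission [Finite E] {N : Network V E s} {A B O : Type*}
    [AddCommGroup B] {k n : ℕ} (c : N.Code A B O k n) (x : Fin s → Fin k → A)
    (z : E → Fin n → B) : ∃! u, c.IsTransmission x z u := by
  classical
  have wf := N.wellFounded_edges
  let F : (e : E) → ((d : E) → N.head d = N.tail e → (Fin n → B)) → (Fin n → B) :=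
    fun e ih => if h : ∃ i, N.tail e = N.source i then c.srcEnc h.choose e (x h.choose) + z e
      else c.relayEnc e (fun d => ih d.1 d.2) + z e
  have hu : ∀ e, wf.fix F e = F e (fun d _ => wf.fix F d) := fun e => wf.fix_eq F e
  refine ⟨wf.fix F, ⟨fun e i hi => ?_, fun e he => ?_⟩, fun u hu' => ?_⟩
  · have h : ∃ i, N.tail e = N.source i := ⟨i, hi⟩
    have hc : h.choose = i := N.source_injective (h.choose_spec.symm.trans hi)
    rw [hu]
    simp only [F, dif_pos h, hc]
  · have h : ¬ ∃ i, N.tail e = N.source i := fun ⟨i, hi⟩ => he i hi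
    rw [hu]
    simp only [F, dif_neg h]
  · funext e
    induction e using wf.induction with
    | _ e ih =>
      rw [hu]
      by_cases h : ∃ i, N.tail e = N.source i
      · simp only [F, dif_pos h]
        exact hu'.of_source e _ h.choose_spec
      · simp only [F, dif_neg h]
        rw [hu'.of_relay e (fun i hi => h ⟨i, hi⟩)]
        congr 2
        funext d
        exact ih d.1 d.2

end Network

/-! The code runs the network as a linear code with `l` symbols per edge, symbol `j` serving column
`j` of `T`; for each `j` the sink must recover the message vector `∑ i, T i j • x i` in `F ^ k`,
where `k` is the minimum cut size minus `2 * τ`. Give each edge `e` a vector `w e` in `F ^ (k + 2 *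
τ)`, the effect at the sink of one unit injected on `e`; relays make this consistent by writing `w
e` as a combination of the vectors of the edges leaving its head. The sink then sees the sum of all
injections, weighted by `w` (`sum_smul_head_eq_sink`). Generic choices, made upstream from the sink,
give every set of edges the rank its blocking sets permit (`exists_isGenericOn_univ`), so the edges
leaving each source span the whole space. All sources can thus use one common injective encoding
`G`, and the network adds their messages for free. The range of `G` avoids every span of `2 * τ`
edge vectors (`exists_linearMap_forall_eq_zero`), so two sets of `τ` errors cannot confuse distinct
sums. Both generic choices avoid at most `2 ^ |E|` subspaces, whence the bound on `q`. -/

section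

open Finset Submodule Module

/-! ### Avoiding finitely many subspaces -/

/-- Over a field with more than `#s` elements, a subspace `U` is not covered by the subspaces
`W i`, `i ∈ s`, none of which contains `U`. -/
theorem Submodule.exists_mem_forall_notMem_of_card_lt {F M ι : Type*} [Field F] [Fintype F]
    [AddCommGroup M] [Module F M] (U : Submodule F M) (W : ι → Submodule F M) (s : Finset ι)
    (hs : s.card < Fintype.card F) (hW : ∀ i ∈ s, ¬ U ≤ W i) :
    ∃ x ∈ U, ∀ i ∈ s, x ∉ W i := by
  classical
  induction s using Finset.induction_on with
  | empty => exact ⟨0, U.zero_mem, by simp⟩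
  | insert a s ha ih =>
    rw [Finset.card_insert_of_notMem ha] at hs
    obtain ⟨x, hxU, hx⟩ := ih (by omega) fun i hi => hW i (Finset.mem_insert_of_mem hi)
    by_cases hxa : x ∈ W a
    swap
    · exact ⟨x, hxU, fun i hi => (Finset.mem_insert.1 hi).elim (fun h => h ▸ hxa) (hx i)⟩
    obtain ⟨y, hyU, hya⟩ := SetLike.not_le_iff_exists.1 (hW a (Finset.mem_insert_self a s))
    -- Each `W i` with `i ∈ s` contains at most one point of the line `y + c • x`, so some `c`
    -- escapes them all.
    have huniq : ∀ i ∈ s, ∀ c c' : F, y + c • x ∈ W i → y + c' • x ∈ W i → c = c' := by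
      intro i hi c c' hc hc'
      by_contra hne
      have h : (c - c') • x ∈ W i := by
        have := (W i).sub_mem hc hc'
        rwa [add_sub_add_left_eq_sub, ← sub_smul] at this
      exact hx i hi (((W i).smul_mem_iff (sub_ne_zero.2 hne)).1 h)
    obtain ⟨c, hc⟩ : ∃ c : F, ∀ i ∈ s, y + c • x ∉ W i := by
      by_contra! hcon
      choose f hfs hf using hcon
      have hle := Finset.card_le_card_of_injOn (s := (Finset.univ : Finset F)) (t := s) f
        (fun c _ => hfs c) (fun c _ c' _ h => huniq _ (hfs c) c c' (hf c) (h ▸ hf c'))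
      rw [Finset.card_univ] at hle
      omega
    refine ⟨y + c • x, U.add_mem hyU (U.smul_mem c hxU), fun i hi => ?_⟩
    rcases Finset.mem_insert.1 hi with rfl | hi
    · exact fun h => hya (((W i).add_mem_iff_left ((W i).smul_mem c hxa)).1 h)
    · exact hc i hi

/-- Over a field with more than `#s` elements, finitely many subspaces of codimension at least `k`
have a common `k`-dimensional subspace meeting each of them trivially. -/
theorem Submodule.exists_linearMap_forall_eq_zero {F M ι : Type*} [Field F] [Fintype F]
    [AddCommGroup M] [Module F M] [FiniteDimensional F M] (W : ι → Submodule F M) (s : Finset ι)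
    (hs : s.card < Fintype.card F) (k : ℕ) (hW : ∀ i ∈ s, finrank F (W i) + k ≤ finrank F M) :
    ∃ G : (Fin k → F) →ₗ[F] M, ∀ i ∈ s, ∀ c, G c ∈ W i → c = 0 := by
  induction k with
  | zero => exact ⟨0, fun i _ c _ => Subsingleton.elim _ _⟩
  | succ k ih =>
    obtain ⟨G, hG⟩ := ih fun i hi => by have := hW i hi; omega
    obtain ⟨g, -, hg⟩ := exists_mem_forall_notMem_of_card_lt (⊤ : Submodule F M)
      (fun i => W i ⊔ LinearMap.range G) s hs (fun i hi h => by
        have h1 := Submodule.finrank_add_le_finrank_add_finrank (W i) (LinearMap.range G)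
        have h2 := LinearMap.finrank_range_le G
        rw [top_le_iff.1 h, finrank_top] at h1
        rw [finrank_fin_fun] at h2
        have := hW i hi
        omega)
    refine ⟨G ∘ₗ LinearMap.funLeft F F Fin.succ + (LinearMap.proj 0).smulRight g,
      fun i hi c hc => ?_⟩
    simp only [LinearMap.add_apply, LinearMap.comp_apply, LinearMap.smulRight_apply,
      LinearMap.proj_apply] at hc
    have h0 : c 0 = 0 := by
      by_contra h0
      refine hg i hi (((W i ⊔ LinearMap.range G).smul_mem_iff h0).1 ?_)
      have h1 : G (LinearMap.funLeft F F Fin.succ c) ∈ W i ⊔ LinearMap.range G :=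
        le_sup_right (a := W i) (LinearMap.mem_range_self G _)
      exact ((W i ⊔ LinearMap.range G).add_mem_iff_right h1).1 (le_sup_left (a := W i) hc)
    rw [h0, zero_smul, add_zero] at hc
    have h1 := hG i hi _ hc
    funext j
    refine Fin.cases h0 (fun j => ?_) j
    exact congrFun h1 j

/-! ### Paths and blocking sets -/

theorem DirMultigraph.IsPath.eq_single_or_cons {V E : Type*} {G : DirMultigraph V E} {u v : V}
    {p : List E} (h : G.IsPath u v p) :
    (∃ e, u = G.tail e ∧ v = G.head e ∧ p = [e]) ∨
      ∃ e q, u = G.tail e ∧ p = e :: q ∧ G.IsPath (G.head e) v q := by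
  cases h with
  | single e => exact .inl ⟨e, rfl, rfl, rfl⟩
  | cons e hp => exact .inr ⟨e, _, rfl, rfl, hp⟩

namespace Network

variable {V E : Type*} {s : ℕ}

/-- `C` meets every path to the sink whose first edge is in `A`. -/
def Blocks (N : Network V E s) (C A : Finset E) : Prop :=
  ∀ e ∈ A, ∀ v p, N.IsPath v N.sink (e :: p) → ∃ d ∈ e :: p, d ∈ C

theorem tail_ne_sink (N : Network V E s) (e : E) : N.tail e ≠ N.sink := by
  intro h
  by_cases h' : N.head e = N.sink
  · exact N.acyclic N.sink [e] (by
      have := DirMultigraph.IsPath.single (G := N.toDirMultigraph) e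
      rwa [h, h'] at this)
  · obtain ⟨p, hp⟩ := N.path_to_sink _ h'
    exact N.acyclic N.sink (e :: p) (by
      have := DirMultigraph.IsPath.cons (G := N.toDirMultigraph) e hp
      rwa [h] at this)

/-- Outside a proper set of edges, some edge has all edges it leads to inside the set. -/
theorem exists_notMem_forall_successor_mem [Finite E] (N : Network V E s) (P : Finset E)
    (hP : ∃ e, e ∉ P) : ∃ e ∉ P, ∀ d, N.tail d = N.head e → d ∈ P := by
  have wf := N.wellFounded_edges.transGen
  let r : E → E → Prop :=
    fun d e => Relation.TransGen (fun d e : E => N.head d = N.tail e) e d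
  have : IsTrans E r := ⟨fun _ _ _ h1 h2 => Relation.TransGen.trans h2 h1⟩
  have : Std.Irrefl r := ⟨fun e h => wf.irrefl.irrefl e h⟩
  have wf' : WellFounded r := Finite.wellFounded_of_trans_of_irrefl r
  obtain ⟨e, he, hmin⟩ := wf'.has_min {e | e ∉ P} hP
  refine ⟨e, he, fun d hd => ?_⟩
  by_contra hdP
  exact hmin d hdP (.single hd.symm)

theorem Blocks.mono {N : Network V E s} {C A B : Finset E} (h : N.Blocks C B) (hAB : A ⊆ B) :
    N.Blocks C A := fun e he => h e (hAB he)

theorem Blocks.insert [DecidableEq E] {N : Network V E s} {C A : Finset E} (h : N.Blocks C A)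
    (e : E) : N.Blocks (insert e C) (insert e A) := by
  intro d hd v p hp
  rcases Finset.mem_insert.1 hd with rfl | hd
  · exact ⟨d, by simp⟩
  · obtain ⟨x, hx, hxC⟩ := h d hd v p hp
    exact ⟨x, hx, Finset.mem_insert_of_mem hxC⟩

/-- What blocks the edges leaving the head of `e` blocks `e`. -/
theorem Blocks.insert_of_successor [DecidableEq E] {N : Network V E s} {C A : Finset E}
    (h : N.Blocks C A) {e : E} (he : N.head e ≠ N.sink)
    (hA : ∀ d, N.tail d = N.head e → d ∈ A) : N.Blocks C (Insert.insert e A) := by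
  intro d hd v p hp
  rcases Finset.mem_insert.1 hd with rfl | hd
  · rcases hp.eq_single_or_cons with ⟨e, -, h2, h3⟩ | ⟨e, q, -, h2, h3⟩
    · rw [List.cons.injEq] at h3
      exact absurd (h3.1 ▸ h2.symm) he
    · rw [List.cons.injEq] at h2
      obtain ⟨rfl, rfl⟩ := h2
      obtain ⟨e', q, h4, rfl⟩ : ∃ e' q, N.tail e' = N.head d ∧ p = e' :: q := by
        rcases h3.eq_single_or_cons with ⟨e', h4, -, h5⟩ | ⟨e', q, h4, h5, -⟩
        · exact ⟨e', [], h4.symm, h5⟩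
        · exact ⟨e', q, h4.symm, h5⟩
      obtain ⟨x, hx, hxC⟩ := h e' (hA e' h4) _ q h3
      exact ⟨x, List.mem_cons_of_mem _ hx, hxC⟩
  · exact h d hd v p hp

/-! ### Generic coding vectors -/

section Generic

variable [Fintype E] {F M : Type*} [Field F] [AddCommGroup M] [Module F M]

/-- The coding vectors `w` of the edges in the successor-closed set `P` form a generic linear
code, run backwards from the sink: the rank of the vectors of a set of edges is as large as the
cuts permit. -/
structure IsGenericOn (N : Network V E s) (F : Type*) [Field F] [Module F M]
    (w : E → M) (P : Finset E) : Prop where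
  closed : ∀ e ∈ P, ∀ d, N.tail d = N.head e → d ∈ P
  mem_span : ∀ e ∈ P, N.head e ≠ N.sink → w e ∈ span F (w '' {d | N.tail d = N.head e})
  exists_blocks : ∀ A ⊆ P, ∃ C, N.Blocks C A ∧
    min (finrank F M) C.card ≤ finrank F (span F (w '' (A : Set E)))

/-- The new vector is taken in the allowed space `U` but outside every span of edge vectors that
does not contain `U`. Adding `e` to a set then either raises the rank, which pays for adding `e` to
the blocking set, or the span already contains `U`, and the successors of `e` could be added for
free. -/
theorem IsGenericOn.exists_insert [DecidableEq E] [Fintype F] [FiniteDimensional F M]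
    (hF : 2 ^ Fintype.card E < Fintype.card F) {N : Network V E s} {w : E → M} {P : Finset E}
    (h : N.IsGenericOn F w P) {e : E} (he : e ∉ P) (heP : ∀ d, N.tail d = N.head e → d ∈ P) :
    ∃ w' : E → M, N.IsGenericOn F w' (insert e P) := by
  classical
  let U : Submodule F M :=
    if N.head e = N.sink then ⊤ else span F (w '' {d | N.tail d = N.head e})
  obtain ⟨x, hxU, hx⟩ := U.exists_mem_forall_notMem_of_card_lt
    (fun A : Finset E => span F (w '' (A : Set E)))
    (univ.filter fun A : Finset E => ¬ U ≤ span F (w '' (A : Set E)))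
    ((Finset.card_le_univ _).trans_lt (by rwa [Fintype.card_finset]))
    (fun A hA => (Finset.mem_filter.1 hA).2)
  have himage : ∀ S : Set E, e ∉ S → Function.update w e x '' S = w '' S := fun S hS =>
    Set.image_congr fun d hd => Function.update_of_ne (ne_of_mem_of_not_mem hd hS) x w
  -- No edge of `insert e P` leads to `e`, so changing `w e` leaves the earlier span conditions
  -- intact.
  have hclosed : ∀ d ∈ insert e P, ∀ d', N.tail d' = N.head d → d' ∈ P := fun d hd d' hd' => by
    rcases Finset.mem_insert.1 hd with rfl | hd
    · exact heP d' hd'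
    · exact h.closed d hd d' hd'
  refine ⟨Function.update w e x, fun d hd d' hd' => Finset.mem_insert_of_mem (hclosed d hd d' hd'),
    fun d hd hsink => ?_, fun A hA => ?_⟩
  · rw [himage _ fun hde => he (hclosed d hd e hde)]
    rcases Finset.mem_insert.1 hd with rfl | hdP
    · rw [Function.update_self]
      simpa only [U, if_neg hsink] using hxU
    · rw [Function.update_of_ne (ne_of_mem_of_not_mem hdP he)]
      exact h.mem_span d hdP hsink
  by_cases heA : e ∈ A
  swap
  · rw [himage _ (by exact_mod_cast heA)]
    exact h.exists_blocks A fun d hd => Finset.mem_of_mem_insert_of_ne (hA hd)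
      (fun hde => heA (hde ▸ hd))
  obtain ⟨B, heB, rfl⟩ : ∃ B, e ∉ B ∧ insert e B = A :=
    ⟨A.erase e, Finset.notMem_erase e A, Finset.insert_erase heA⟩
  have hBP : B ⊆ P := fun d hd => Finset.mem_of_mem_insert_of_ne
    (hA (Finset.mem_insert_of_mem hd)) (fun hde => heB (hde ▸ hd))
  rw [Finset.coe_insert, Set.image_insert_eq, Function.update_self,
    himage _ (by exact_mod_cast heB)]
  by_cases hUB : U ≤ span F (w '' (B : Set E))
  · by_cases hsink : N.head e = N.sink
    -- Here `U = ⊤`: the rank is already full, so any blocking set will do.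
    · refine ⟨univ, fun d _ v p _ => ⟨d, by simp⟩, (min_le_left _ _).trans ?_⟩
      rw [span_insert, top_le_iff.1 (by simpa only [U, if_pos hsink] using hUB :
        ⊤ ≤ span F (w '' (B : Set E))), sup_top_eq, finrank_top]
    · have hspan : span F (w '' (B ∪ univ.filter fun d => N.tail d = N.head e : Finset E)) ≤
          span F (insert x (w '' (B : Set E))) := by
        rw [Finset.coe_union, Set.image_union, span_union]
        refine sup_le (span_mono (Set.subset_insert _ _)) ?_
        refine le_trans ?_ (hUB.trans (span_mono (Set.subset_insert _ _)))
        simp [U, if_neg hsink]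
      obtain ⟨C, hC, hle⟩ := h.exists_blocks (B ∪ univ.filter fun d => N.tail d = N.head e)
        (Finset.union_subset hBP fun d hd => heP d (Finset.mem_filter.1 hd).2)
      exact ⟨C, (hC.insert_of_successor hsink fun d hd => by simp [hd]).mono
        (Finset.insert_subset_insert _ Finset.subset_union_left),
        hle.trans (Submodule.finrank_mono hspan)⟩
  · obtain ⟨C, hC, hle⟩ := h.exists_blocks B hBP
    refine ⟨insert e C, hC.insert e, ?_⟩
    have hlt : span F (w '' (B : Set E)) < span F (insert x (w '' (B : Set E))) :=
      lt_of_le_of_ne (span_mono (Set.subset_insert _ _)) fun heq =>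
        hx B (Finset.mem_filter.2 ⟨Finset.mem_univ _, hUB⟩)
          (heq ▸ subset_span (Set.mem_insert _ _))
    have h1 := Submodule.finrank_lt_finrank_of_lt hlt
    have h2 := Finset.card_insert_le e C
    omega

theorem exists_isGenericOn_univ [Fintype F] [FiniteDimensional F M]
    (hF : 2 ^ Fintype.card E < Fintype.card F) (N : Network V E s) :
    ∃ w : E → M, N.IsGenericOn F w univ := by
  classical
  have key : ∀ n ≤ Fintype.card E, ∃ P : Finset E, P.card = n ∧
      ∃ w : E → M, N.IsGenericOn F w P := by
    intro n
    induction n with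
    | zero =>
      refine fun _ => ⟨∅, rfl, 0, by simp, by simp, fun A hA => ⟨∅, ?_, by simp⟩⟩
      rw [Finset.subset_empty.1 hA]
      exact fun e he => by simp at he
    | succ n ih =>
      intro hn
      obtain ⟨P, hP, w, hw⟩ := ih (by omega)
      obtain ⟨e, he, heP⟩ := N.exists_notMem_forall_successor_mem P (by
        by_contra! hall
        rw [Finset.eq_univ_iff_forall.2 hall, Finset.card_univ] at hP
        omega)
      exact ⟨insert e P, by rw [Finset.card_insert_of_notMem he, hP],
        hw.exists_insert hF he heP⟩
  obtain ⟨P, hP, w, hw⟩ := key _ le_rfl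
  rw [Finset.card_eq_iff_eq_univ] at hP
  exact ⟨w, hP ▸ hw⟩

end Generic

/-! ### Cuts and conservation of flow -/

/-- A set of edges blocking all edges that leave a source is a cut. -/
theorem Blocks.mem_cuts {N : Network V E s} {C A : Finset E} {i : Fin s} (h : N.Blocks C A)
    (hA : ∀ e, N.tail e = N.source i → e ∈ A) : C ∈ N.cuts := by
  refine ⟨i, fun p hp => ?_⟩
  obtain ⟨e, q, h1, rfl⟩ : ∃ e q, N.tail e = N.source i ∧ p = e :: q := by
    rcases hp.eq_single_or_cons with ⟨e, h1, -, h2⟩ | ⟨e, q, h1, h2, -⟩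
    · exact ⟨e, [], h1.symm, h2⟩
    · exact ⟨e, q, h1.symm, h2⟩
  exact h e (hA e h1) _ _ hp

theorem univ_mem_cuts [Fintype E] (N : Network V E s) (i : Fin s) : univ ∈ N.cuts := by
  refine ⟨i, fun p hp => ?_⟩
  rcases hp.eq_single_or_cons with ⟨e, -, -, rfl⟩ | ⟨e, q, -, rfl, -⟩ <;> exact ⟨e, by simp⟩

/-- Conservation of flow for a linear code with coding vectors `w`: what arrives at the sink is
what is injected into the network. -/
theorem sum_smul_head_eq_sink {F M : Type*} [Fintype E] [DecidableEq V] [Field F] [AddCommGroup M]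
    [Module F M] (N : Network V E s) (w : E → M) (a : E → E → F) (u b : E → F)
    (hw : ∀ d, N.head d ≠ N.sink → w d = ∑ e with N.tail e = N.head d, a d e • w e)
    (hu : ∀ e, u e = b e + ∑ d with N.head d = N.tail e, a d e * u d) :
    ∑ d with N.head d = N.sink, u d • w d = ∑ e, b e • w e := by
  have h1 : ∑ e, u e • w e = ∑ e, b e • w e +
      ∑ d with N.head d ≠ N.sink, u d • w d := by
    calc ∑ e, u e • w e
        = ∑ e, (b e • w e + ∑ d, if N.head d = N.tail e then u d • a d e • w e else 0) := by
          refine Finset.sum_congr rfl fun e _ => ?_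
          rw [hu e, add_smul, Finset.sum_smul, Finset.sum_filter]
          congr 1
          refine Finset.sum_congr rfl fun d _ => ?_
          split_ifs
          · rw [smul_smul, mul_comm]
          · rfl
      _ = ∑ e, b e • w e +
          ∑ d, ∑ e, if N.head d = N.tail e then u d • a d e • w e else 0 := by
          rw [Finset.sum_add_distrib]
          congr 1
          exact Finset.sum_comm
      _ = _ := by
          rw [Finset.sum_filter]
          congr 1
          refine Finset.sum_congr rfl fun d _ => ?_
          split_ifs with hd
          · rw [hw d hd, Finset.smul_sum, Finset.sum_filter]
            exact Finset.sum_congr rfl fun e _ => by simp only [eq_comm]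
          · rw [not_not] at hd
            refine Finset.sum_eq_zero fun e _ => if_neg fun h => ?_
            exact N.tail_ne_sink e (h.symm.trans hd)
  rw [← Finset.sum_filter_add_sum_filter_not univ (fun d => N.head d = N.sink)] at h1
  exact add_right_cancel h1

/-- Coefficients expressing a vector of the span of the `w d`, `p d`. -/
theorem exists_coeff_of_mem_span {F M : Type*} [Fintype E] [Field F] [AddCommGroup M] [Module F M]
    (w : E → M) (p : E → Prop) [DecidablePred p] {x : M} (hx : x ∈ span F (w '' {d | p d})) :
    ∃ a : E → F, x = ∑ d with p d, a d • w d := by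
  have h : x ∈ span F (w '' ((univ.filter p : Finset E) : Set E)) := by simpa using hx
  obtain ⟨a, ha⟩ := (Submodule.mem_span_image_finset_iff_exists_fun F).1 h
  classical
  refine ⟨fun e => if h : e ∈ univ.filter p then a ⟨e, h⟩ else 0, ?_⟩
  rw [← ha, ← Finset.sum_coe_sort (univ.filter p)]
  exact Finset.sum_congr rfl fun e _ => by simp only [dif_pos e.2]

/-! ### The error-correcting code -/

/-- A code computing `x ↦ x T` at rate `k / l` against `τ` errors, for `k + 2 τ` at most the size
of every cut. -/
theorem exists_code_computesAgainst [Fintype E] (N : Network V E s) {F : Type*} [Field F]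
    [Fintype F] (hF : 2 ^ Fintype.card E < Fintype.card F) (τ k : ℕ)
    (hk : ∀ C ∈ N.cuts, k + 2 * τ ≤ C.card) {l : ℕ} (T : Matrix (Fin s) (Fin l) F) :
    ∃ c : N.Code F F (Fin l → F) k l,
      c.ComputesAgainst (fun x : Fin s → F => Matrix.vecMul x T) τ := by
  classical
  obtain ⟨w, hw⟩ := N.exists_isGenericOn_univ (M := Fin (k + 2 * τ) → F) hF
  have htop : ∀ i, span F (w '' {d | N.tail d = N.source i}) = ⊤ := by
    intro i
    obtain ⟨C, hC, hle⟩ := hw.exists_blocks (univ.filter fun d => N.tail d = N.source i)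
      (Finset.subset_univ _)
    have h1 := hk C (hC.mem_cuts (i := i) fun e he => by simp [he])
    rw [finrank_fin_fun, min_eq_left h1] at hle
    refine Submodule.eq_top_of_finrank_eq (le_antisymm (Submodule.finrank_le _) ?_)
    rwa [finrank_fin_fun, ← Finset.coe_filter_univ]
  obtain ⟨G, hG⟩ := Submodule.exists_linearMap_forall_eq_zero
    (fun A : Finset E => span F (w '' (A : Set E)))
    (univ.filter fun A : Finset E => A.card ≤ 2 * τ)
    ((Finset.card_le_univ _).trans_lt (by rwa [Fintype.card_finset])) k (fun A hA => by
      have h1 := finrank_span_finset_le_card (R := F) (A.image w)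
      rw [Finset.coe_image] at h1
      have h2 := Finset.card_image_le (s := A) (f := w)
      have h3 := (Finset.mem_filter.1 hA).2
      rw [finrank_fin_fun]
      simp only [Set.finrank] at h1
      omega)
  have ha : ∀ d, ∃ a : E → F, N.head d ≠ N.sink →
      w d = ∑ e with N.tail e = N.head d, a e • w e := by
    intro d
    by_cases hd : N.head d = N.sink
    · exact ⟨0, fun h => absurd hd h⟩
    · obtain ⟨a, ha⟩ := exists_coeff_of_mem_span w _ (hw.mem_span d (Finset.mem_univ _) hd)
      exact ⟨a, fun _ => ha⟩
  choose a ha using ha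
  have hb : ∀ i (y : Fin k → F), ∃ b : E → F,
      G y = ∑ e with N.tail e = N.source i, b e • w e := fun i y =>
    exists_coeff_of_mem_span w _ (by rw [htop i]; trivial)
  choose b hb using hb
  let Y : (N.In N.sink → Fin l → F) → Fin l → Fin (k + 2 * τ) → F :=
    fun v j => ∑ d, v d j • w d.1
  -- Decode to any message explaining `Y` by at most `τ` errors; two such messages differ by a
  -- vector that `G` sends into the span of at most `2 * τ` edge vectors, so they agree.
  let D : (Fin (k + 2 * τ) → F) → (Fin k → F) := fun Y =>
    Classical.epsilon fun y => ∃ S : Finset E, S.card ≤ τ ∧ Y - G y ∈ span F (w '' (S : Set E))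
  have hD : ∀ Y y, (∃ S : Finset E, S.card ≤ τ ∧ Y - G y ∈ span F (w '' (S : Set E))) →
      D Y = y := by
    intro Y y hy
    obtain ⟨S', hS', hY'⟩ := Classical.epsilon_spec (p := fun y => ∃ S : Finset E,
      S.card ≤ τ ∧ Y - G y ∈ span F (w '' (S : Set E))) ⟨y, hy⟩
    obtain ⟨S, hS, hY⟩ := hy
    refine sub_eq_zero.1 (hG (S ∪ S') (Finset.mem_filter.2 ⟨Finset.mem_univ _, ?_⟩) _ ?_)
    · have := Finset.card_union_le S S'
      omega
    · have h1 : G (D Y - y) = (Y - G y) - (Y - G (D Y)) := by rw [map_sub]; abel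
      rw [h1]
      refine Submodule.sub_mem _ (span_mono (Set.image_mono ?_) hY)
        (span_mono (Set.image_mono ?_) hY') <;> simp
  refine ⟨⟨fun i e x j => b i (T i j • x) e, fun e v j => ∑ d, a d.1 e * v d j,
    fun v m j => D (Y v j) m⟩, fun x z u hz hu m => ?_⟩
  funext j
  let inj : E → F := fun e => ∑ i with N.tail e = N.source i, b i (T i j • x i) e
  have hflow : Y (fun d => u d.1) j = ∑ e, (inj e + z e j) • w e := by
    rw [← N.sum_smul_head_eq_sink w a (fun e => u e j) _ ha fun e => ?_]
    · exact (Finset.sum_subtype _ (by simp) (fun d => u d j • w d)).symm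
    · by_cases he : ∃ i, N.tail e = N.source i
      · obtain ⟨i, hi⟩ := he
        have h1 : (univ.filter fun i' => N.tail e = N.source i') = {i} := by
          ext i'
          simp only [Finset.mem_filter, Finset.mem_univ, true_and, Finset.mem_singleton, hi]
          exact ⟨fun h => (N.source_injective h).symm, fun h => h ▸ rfl⟩
        have h2 : (univ.filter fun d => N.head d = N.tail e) = ∅ :=
          Finset.filter_eq_empty_iff.2 fun d _ h => N.no_edge_into_source d i (h.trans hi)
        simp only [inj, h1, h2, Finset.sum_singleton, Finset.sum_empty, add_zero]
        rw [hu.of_source e i hi, Pi.add_apply]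
      · rw [not_exists] at he
        have h1 : (univ.filter fun i' => N.tail e = N.source i') = ∅ :=
          Finset.filter_eq_empty_iff.2 fun i _ => he i
        simp only [inj, h1, Finset.sum_empty, zero_add]
        rw [hu.of_relay e he, Pi.add_apply, add_comm]
        congr 1
        exact (Finset.sum_subtype _ (by simp) (fun d => a d e * u d j)).symm
  have hinj : ∑ e, inj e • w e = G (∑ i, T i j • x i) := by
    simp only [inj, Finset.sum_smul, Finset.sum_filter]
    rw [Finset.sum_comm, map_sum]
    refine Finset.sum_congr rfl fun i _ => ?_
    rw [hb i, Finset.sum_filter]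
    exact Finset.sum_congr rfl fun e _ => by rw [ite_smul, zero_smul]
  have hdec : D (Y (fun d => u d.1) j) = ∑ i, T i j • x i := by
    refine hD _ _ ⟨univ.filter fun e => z e ≠ 0, ?_, ?_⟩
    · rwa [Set.ncard_eq_toFinset_card', Set.toFinset_ofPred] at hz
    · simp only [hflow, add_smul, Finset.sum_add_distrib]
      rw [hinj, add_sub_cancel_left]
      refine Submodule.sum_mem _ fun e _ => ?_
      by_cases he : z e = 0
      · simp [he]
      · exact Submodule.smul_mem _ _ (subset_span ⟨e, by simpa using he, rfl⟩)
  change D (Y (fun d => u d.1) j) m = _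
  rw [hdec]
  simp [Matrix.vecMul, dotProduct, Finset.sum_apply, mul_comm]

end Network

end

/-! ### The capacity bound -/

theorem mainTheorem4 {V E : Type*} [Fintype V] [Fintype E] {s : ℕ} (N : Network V E s)
    (τ : ℕ) (hτ : ∀ C ∈ N.cuts, 2 * τ < C.card) :
    ∃ q₀ : ℕ, ∀ (F : Type*) [Field F] [Fintype F], q₀ ≤ Fintype.card F →
      ∀ (l : ℕ), 1 ≤ l → ∀ T : Matrix (Fin s) (Fin l) F,
        LinearIndependent F (fun j i => T i j) →
          (⨅ C ∈ N.cuts, (((((C.card : ℝ) - 2 * (τ : ℝ)) / (l : ℝ)) : ℝ) : EReal)) ≤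
            N.robustCapacity F (fun x : Fin s → F => Matrix.vecMul x T) τ := by
  refine ⟨2 ^ Fintype.card E + 1, fun F _ _ hF l hl T hT => ?_⟩
  -- A source guarantees that a cut exists, so that the minimum is attained.
  obtain ⟨i⟩ : Nonempty (Fin s) := by
    by_contra hs
    rw [not_nonempty_iff] at hs
    exact hT.ne_zero ⟨0, hl⟩ (Subsingleton.elim _ _)
  obtain ⟨C, hC, hmin⟩ := Set.exists_min_image N.cuts Finset.card (Set.toFinite _)
    ⟨_, N.univ_mem_cuts i⟩
  have hCτ := hτ C hC
  obtain ⟨c, hc⟩ := N.exists_code_computesAgainst (F := F) (by omega) τ (C.card - 2 * τ)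
    (fun C' hC' => by have := hmin C' hC'; omega) T
  refine (iInf₂_le C hC).trans (le_sSup ⟨C.card - 2 * τ, l, by omega, hl, ⟨c, hc⟩, ?_⟩)
  rw [Nat.cast_sub hCτ.le]
  push_cast
  rfl
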